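/- Let $A$ be a left artinian algebra over a field $k$ with radical $r$, and write $A/r\cong\bigoplus_{i\in\Delta_0}\overline A_i$ with $\Delta_0$ finite and each $\overline A_i$ a simple $k$-algebra. Let $\Delta_A$ be the natural quiver of $A$: its vertex set is $\Delta_0$, and the number of arrows from $i$ to $j$ is the least number of generators of the $\overline A_j$-$\overline A_i$-bimodule $\overline A_j\cdot (r/r^2)\cdot\overline A_i$. Let $R=k(\Delta_A,\mathcal A)$ be the generalized path algebra of $\Delta_A$ with $\mathcal A=\{\overline A_i\}_{i\in\Delta_0}$, that is, the $k$-algebra generated by $\bigoplus_i\overline A_i$ (the elements of length zero) and the arrows, subject only to $e_j\beta=\beta=\beta e_i$ for each arrow $\beta$ from $i$ to $j$, where $e_i$ is the identity of $\overline A_i$. Let $J\subset R$ be the ideal generated by all paths of length one. For a ring $T$, a complete set of non-isomorphic primitive orthogonal idempotents of $T$, indexed by $\Delta_0$, is a family $(\varepsilon_i)_{i\in\Delta_0}$ of pairwise orthogonal primitive idempotents such that $T\varepsilon_i\not\cong T\varepsilon_j$ as left $T$-modules for $i\ne j$, and for every primitive idempotent $f$ of $T$ there is an $i$ with $Tf\cong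 T\varepsilon_i$. Assume that $A$ is of Gabriel type with an ideal inside $J$: there are a two-sided ideal $I\subset J$ of $R$ and an isomorphism of $k$-algebras $\pi:A\cong R/I$. Let $(\varepsilon_i)_{i\in\Delta_0}$ be a complete set of non-isomorphic primitive orthogonal idempotents of $A$, and let $B=\bigoplus_{i,j}\varepsilon_iA\varepsilon_j$ be the basic algebra of $A$. Let $(d_i)_{i\in\Delta_0}$ be either a complete set of non-isomorphic primitive orthogonal idempotents of $R$, or the family of length-zero elements of $R$ given by such a set of $A/r\cong\bigoplus_i\overline A_i$, and let $C=\bigoplus_{i,j}d_iRd_j$ be the basic algebra of $R$. Then $B\cong (C+I)/I$ as $k$-algebras, where $(C+I)/I$ is the image of $C$ in $R/I$. -/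

import Mathlib

/-! ### Primitive idempotents and basic algebras -/

/-- A primitive idempotent: a nonzero idempotent that is not the sum of two nonzero
orthogonal idempotents. -/
structure IsPrimitiveIdempotent {R : Type*} [Ring R] (e : R) : Prop where
  idem : IsIdempotentElem e
  ne_zero : e ≠ 0
  indecomposable : ∀ a b : R, IsIdempotentElem a → IsIdempotentElem b →
    a * b = 0 → b * a = 0 → e = a + b → a = 0 ∨ b = 0

/-- A complete set of non-isomorphic primitive orthogonal idempotents of `R`, indexed by `ι`.
The left ideal `R e` is `Ideal.span {e}`. -/
structure IsCompletePrimitiveSet {R : Type*} [Ring R] {ι : Type*} (e : ι → R) : Prop where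
  orthogonal : OrthogonalIdempotents e
  primitive : ∀ i, IsPrimitiveIdempotent (e i)
  non_iso : ∀ i j, i ≠ j → IsEmpty (Ideal.span {e i} ≃ₗ[R] Ideal.span {e j})
  complete : ∀ f : R, IsPrimitiveIdempotent f →
    ∃ i, Nonempty (Ideal.span {f} ≃ₗ[R] Ideal.span {e i})

/-- The algebra `⨁_{i,j} e_i R e_j`, as a subset of `R` closed under the operations of `R`.
For orthogonal idempotents `e_i` the sum is direct, and `∑ i, e i` is the identity. It is the
basic algebra of `R` when `e` is a complete set of non-isomorphic primitive orthogonal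
idempotents of `R`. -/
def basicAlgebra (k : Type*) {R : Type*} [Field k] [Ring R] [Algebra k R] {ι : Type*}
    [Fintype ι] (e : ι → R) : NonUnitalSubalgebra k R where
  carrier := {x | ∃ y : ι → ι → R, x = ∑ i, ∑ j, e i * y i j * e j}
  add_mem' := by
    rintro _ _ ⟨y, rfl⟩ ⟨z, rfl⟩
    refine ⟨fun i j => y i j + z i j, ?_⟩
    simp only [mul_add, add_mul, Finset.sum_add_distrib]
  zero_mem' := ⟨fun _ _ => 0, by simp⟩
  mul_mem' := by
    rintro _ _ ⟨y, rfl⟩ ⟨z, rfl⟩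
    refine ⟨fun i l => (∑ j, y i j * e j) * (∑ m, e m * z m l), ?_⟩
    have h1 : ∑ i, ∑ j, e i * y i j * e j = ∑ i, e i * ∑ j, y i j * e j := by
      simp only [Finset.mul_sum, mul_assoc]
    have h2 : ∑ m, ∑ l, e m * z m l * e l = ∑ l, (∑ m, e m * z m l) * e l := by
      rw [Finset.sum_comm]
      simp only [Finset.sum_mul]
    rw [h1, h2, Finset.sum_mul_sum]
    simp only [mul_assoc]
  smul_mem' := by
    rintro c _ ⟨y, rfl⟩
    refine ⟨fun i j => c • y i j, ?_⟩
    simp only [Finset.smul_sum, mul_smul_comm, smul_mul_assoc]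

/-! ### Generalized path algebras

A quiver with vertex set `ι` is given by the types `Q i j` of arrows from `i` to `j`. -/

section GeneralizedPathAlgebra

variable (k : Type*) [Field k] {ι : Type*} [Fintype ι] (Q : ι → ι → Type*)
  (S : ι → Type*) [∀ i, Ring (S i)] [∀ i, Algebra k (S i)]

/-- The letters of which paths are composed: elements of the algebras at the vertices, and
arrows. -/
inductive PathLetter : Type _
  | elt (i : ι) (a : S i) : PathLetter
  | arrow (i j : ι) (β : Q i j) : PathLetter

/-- The defining relations of the generalized path algebra. The free algebra on the letters is
the `k`-space of all words with concatenation as product. The relations make words linear in the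
entries from the algebras `S i`, multiply two neighbouring entries from the same `S i`, annihilate
words that do not compose, and let the identity of `S i` act as the trivial path at `i`.
Paths are composed from right to left: an arrow `β` from `i` to `j` has elements of `S i` on its
right and elements of `S j` on its left. -/
inductive PathRel : FreeAlgebra k (PathLetter Q S) → FreeAlgebra k (PathLetter Q S) → Prop
  | add (i : ι) (a b : S i) : PathRel
      (FreeAlgebra.ι k (.elt i (a + b)))
      (FreeAlgebra.ι k (.elt i a) + FreeAlgebra.ι k (.elt i b))
  | smul (i : ι) (c : k) (a : S i) : PathRel
      (FreeAlgebra.ι k (.elt i (c • a))) (c • FreeAlgebra.ι k (.elt i a))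
  | mul (i : ι) (a b : S i) : PathRel
      (FreeAlgebra.ι k (.elt i a) * FreeAlgebra.ι k (.elt i b))
      (FreeAlgebra.ι k (.elt i (a * b)))
  | mul_of_ne (i j : ι) (h : i ≠ j) (a : S i) (b : S j) : PathRel
      (FreeAlgebra.ι k (.elt i a) * FreeAlgebra.ι k (.elt j b)) 0
  | one : PathRel (∑ i, FreeAlgebra.ι k (.elt i 1)) 1
  | target (i j : ι) (β : Q i j) : PathRel
      (FreeAlgebra.ι k (.elt j 1) * FreeAlgebra.ι k (.arrow i j β))
      (FreeAlgebra.ι k (.arrow i j β))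
  | source (i j : ι) (β : Q i j) : PathRel
      (FreeAlgebra.ι k (.arrow i j β) * FreeAlgebra.ι k (.elt i 1))
      (FreeAlgebra.ι k (.arrow i j β))

/-- The generalized path algebra `k(Q, S)`. -/
def GenPathAlgebra : Type _ := RingQuot (PathRel k Q S)

noncomputable instance : Ring (GenPathAlgebra k Q S) :=
  inferInstanceAs (Ring (RingQuot (PathRel k Q S)))

noncomputable instance : Algebra k (GenPathAlgebra k Q S) :=
  inferInstanceAs (Algebra k (RingQuot (PathRel k Q S)))

namespace GenPathAlgebra

/-- The path of length zero given by an element of the algebra at the vertex `i`. -/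
noncomputable def elt (i : ι) (a : S i) : GenPathAlgebra k Q S :=
  RingQuot.mkAlgHom k (PathRel k Q S) (FreeAlgebra.ι k (.elt i a))

/-- The arrow `β`, as an element of the generalized path algebra. -/
noncomputable def arrow (i j : ι) (β : Q i j) : GenPathAlgebra k Q S :=
  RingQuot.mkAlgHom k (PathRel k Q S) (FreeAlgebra.ι k (.arrow i j β))

/-- The element of length zero given by an element of `⨁ i, S i`. -/
noncomputable def lengthZero (x : ∀ i, S i) : GenPathAlgebra k Q S :=
  ∑ i, elt k Q S i (x i)

/-- The ideal `J` generated by all paths of length one. -/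
noncomputable def arrowIdeal : Ideal (GenPathAlgebra k Q S) :=
  (TwoSidedIdeal.span {x : GenPathAlgebra k Q S | ∃ (i j : ι) (β : Q i j) (b : S j) (a : S i),
    x = elt k Q S j b * arrow k Q S i j β * elt k Q S i a}).asIdeal

end GenPathAlgebra

end GeneralizedPathAlgebra

/-! ### The natural quiver

`r = Ring.jacobson A` is the radical, and `φ` presents `A / r` as the direct sum of the simple
algebras `S i`. The bimodule `r / r²` is viewed inside the ring `A / r²`, where `A` acts on it
from both sides, through `A / r`. -/

section NaturalQuiver

variable {k A : Type*} [Field k] [Ring A] [Algebra k A] {ι : Type*} [DecidableEq ι]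
  {S : ι → Type*} [∀ i, Ring (S i)] [∀ i, Algebra k (S i)]
  (φ : (A ⧸ Ring.jacobson A) ≃ₐ[k] (∀ i, S i))

/-- The class of `a` in `A / r` lies in the simple ideal that corresponds to `S i`. -/
def InBlock (i : ι) (a : A) : Prop :=
  ∃ s : S i, φ (Ideal.Quotient.mk (Ring.jacobson A) a) = Pi.single i s

/-- The sub-bimodule of `r / r²` generated by `X` under the `i`-th block on the left
and the `j`-th block on the right. -/
def blockSpan (i j : ι) (X : Set (A ⧸ Ring.jacobson A ^ 2)) :
    AddSubgroup (A ⧸ Ring.jacobson A ^ 2) :=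
  AddSubgroup.closure {m | ∃ a b : A, ∃ x ∈ X, InBlock φ i a ∧ InBlock φ j b ∧
    m = Ideal.Quotient.mk (Ring.jacobson A ^ 2) a * x *
      Ideal.Quotient.mk (Ring.jacobson A ^ 2) b}

/-- The component `ᵢMⱼ = S i · r/r² · S j` of `r / r²`. -/
def radicalComponent (i j : ι) : AddSubgroup (A ⧸ Ring.jacobson A ^ 2) :=
  blockSpan φ i j (Ideal.Quotient.mk (Ring.jacobson A ^ 2) '' (Ring.jacobson A : Set A))

/-- The rank of the bimodule `ᵢMⱼ`: the least number of elements that generate it. If `A` is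
left artinian, a finite set of generators exists. -/
noncomputable def radicalRank (i j : ι) : ℕ :=
  sInf {n | ∃ X : Finset (A ⧸ Ring.jacobson A ^ 2), X.card = n ∧
    (X : Set (A ⧸ Ring.jacobson A ^ 2)) ⊆ radicalComponent φ i j ∧
    blockSpan φ i j (X : Set (A ⧸ Ring.jacobson A ^ 2)) = radicalComponent φ i j}

/-- The natural quiver of `A`: the number of arrows from `i` to `j` is the rank of `ⱼMᵢ`. -/
abbrev NaturalQuiver (i j : ι) : Type := Fin (radicalRank φ j i)

end NaturalQuiver

/-! The basic algebra of an orthogonal family `e` is the corner `E R E` with `E = ∑ i, e i`. If `E =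
x * y` and `F = y * x` are equivalent, then `a ↦ y * a * x` identifies the two corners. A surjection
carries corners to corners, so it suffices to match, up to equivalence and a permutation, the
idempotents `π (ε i)` with the images of the `d i` in `R / I`.

The matching goes through pairwise inequivalent primitive idempotents `δ i` of `∀ i, S i`, placed in
`R` as elements of length zero. The augmentation `R → ∀ i, S i` splits this inclusion and kills `J ⊇
I`, hence induces a surjection from `A`. Neither map has a nonzero idempotent in its kernel: for `R`
by the length grading, for `A` because the kernel lies in the radical. Hence the `δ i` give
primitive idempotents in both `R` and `A`, still inequivalent since equivalence passes to images. As
many of them as a complete set has members must exhaust it. -/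

/-! ### Equivalent idempotents -/

/-- Equivalence of idempotents: `e = x * y` and `f = y * x`, where `x ∈ e R f` and `y ∈ f R e`. -/
def IdempotentEquiv {R : Type*} [Ring R] (e f : R) : Prop :=
  ∃ x y : R, x * y = e ∧ y * x = f ∧ e * x = x ∧ x * f = x ∧ f * y = y ∧ y * e = y

namespace IdempotentEquiv

variable {R T : Type*} [Ring R] [Ring T]

theorem refl {e : R} (he : IsIdempotentElem e) : IdempotentEquiv e e :=
  ⟨e, e, he.eq, he.eq, he.eq, he.eq, he.eq, he.eq⟩

theorem symm {e f : R} (h : IdempotentEquiv e f) : IdempotentEquiv f e := by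
  obtain ⟨x, y, h1, h2, h3, h4, h5, h6⟩ := h
  exact ⟨y, x, h2, h1, h5, h6, h3, h4⟩

theorem trans {e f g : R} (h : IdempotentEquiv e f) (h' : IdempotentEquiv f g) :
    IdempotentEquiv e g := by
  obtain ⟨x, y, h1, h2, h3, h4, h5, h6⟩ := h
  obtain ⟨z, w, k1, k2, k3, k4, k5, k6⟩ := h'
  refine ⟨x * z, w * y, ?_, ?_, ?_, ?_, ?_, ?_⟩
  · rw [mul_assoc, ← mul_assoc z, k1, h5, h1]
  · rw [mul_assoc, ← mul_assoc y, h2, k3, k2]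
  · rw [← mul_assoc, h3]
  · rw [mul_assoc, k4]
  · rw [← mul_assoc, k5]
  · rw [mul_assoc, h6]

theorem map (g : R →+* T) {e f : R} (h : IdempotentEquiv e f) :
    IdempotentEquiv (g e) (g f) := by
  obtain ⟨x, y, h1, h2, h3, h4, h5, h6⟩ := h
  refine ⟨g x, g y, ?_, ?_, ?_, ?_, ?_, ?_⟩ <;> simp only [← map_mul, *]

/-- Every `a ∈ R e` equals `a • e`, so `g` is right multiplication by `x = g e`, and its inverse is
right multiplication by `y = g⁻¹ f`. -/
theorem of_linearEquiv {e f : R} (he : IsIdempotentElem e) (hf : IsIdempotentElem f)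
    (g : Ideal.span {e} ≃ₗ[R] Ideal.span {f}) : IdempotentEquiv e f := by
  have mul_self {e : R} (he : IsIdempotentElem e) (a : Ideal.span {e}) : (a : R) * e = a := by
    obtain ⟨c, hc⟩ := Ideal.mem_span_singleton'.1 a.2
    rw [← hc, mul_assoc, he.eq]
  let e' : Ideal.span {e} := ⟨e, Ideal.mem_span_singleton_self e⟩
  let f' : Ideal.span {f} := ⟨f, Ideal.mem_span_singleton_self f⟩
  have he' (a : Ideal.span {e}) : (a : R) • e' = a := Subtype.ext (mul_self he a)
  have hf' (a : Ideal.span {f}) : (a : R) • f' = a := Subtype.ext (mul_self hf a)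
  refine ⟨g e', g.symm f', ?_, ?_, ?_, mul_self hf _, ?_, mul_self he _⟩
  · have : (g e' : R) • g.symm f' = e' := by rw [← map_smul, hf', g.symm_apply_apply]
    exact congrArg Subtype.val this
  · have : (g.symm f' : R) • g e' = f' := by rw [← map_smul, he', g.apply_symm_apply]
    exact congrArg Subtype.val this
  · have : e • g e' = g e' := by rw [← map_smul]; exact congrArg g (he' e')
    exact congrArg Subtype.val this
  · have : f • g.symm f' = g.symm f' := by rw [← map_smul]; exact congrArg g.symm (hf' f')
    exact congrArg Subtype.val this

theorem nonempty_linearEquiv {e f : R} (h : IdempotentEquiv e f) :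
    Nonempty (Ideal.span {e} ≃ₗ[R] Ideal.span {f}) := by
  obtain ⟨x, y, h1, h2, h3, h4, h5, h6⟩ := h
  have mem {e f x : R} (hx : x * f = x) (a : R) : a * x ∈ Ideal.span {f} :=
    Ideal.mem_span_singleton'.2 ⟨a * x, by rw [mul_assoc, hx]⟩
  refine ⟨LinearEquiv.ofLinearMap
    (LinearMap.codRestrict _ ((LinearMap.toSpanSingleton R R x).comp (Submodule.subtype _))
      fun a => mem (e := e) h4 a)
    (LinearMap.codRestrict _ ((LinearMap.toSpanSingleton R R y).comp (Submodule.subtype _))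
      fun a => mem (e := f) h6 a) ?_ ?_⟩
  · ext ⟨a, ha⟩
    obtain ⟨c, rfl⟩ := Ideal.mem_span_singleton'.1 ha
    change c * f * y * x = c * f
    rw [mul_assoc, mul_assoc, ← mul_assoc f, h5, h2]
  · ext ⟨a, ha⟩
    obtain ⟨c, rfl⟩ := Ideal.mem_span_singleton'.1 ha
    change c * e * x * y = c * e
    rw [mul_assoc, mul_assoc, ← mul_assoc e, h3, h1]

end IdempotentEquiv

/-! ### Primitive idempotents -/

/-- A splitting of `e` maps to a splitting of `g e`, where one part vanishes; that part was already
zero because the kernel has no other idempotents. -/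
theorem IsPrimitiveIdempotent.of_map {R T : Type*} [Ring R] [Ring T] (g : R →+* T)
    (hg : ∀ a : R, IsIdempotentElem a → g a = 0 → a = 0) {e : R} (he : IsIdempotentElem e)
    (h : IsPrimitiveIdempotent (g e)) : IsPrimitiveIdempotent e where
  idem := he
  ne_zero h0 := h.ne_zero (by rw [h0, map_zero])
  indecomposable a b ha hb hab hba hsum :=
    (h.indecomposable (g a) (g b) (ha.map g) (hb.map g)
      (by rw [← map_mul, hab, map_zero]) (by rw [← map_mul, hba, map_zero])
      (by rw [hsum, map_add])).imp (hg a ha) (hg b hb)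

theorem IsPrimitiveIdempotent.map_equiv {R T : Type*} [Ring R] [Ring T] (g : R ≃+* T) {e : R}
    (h : IsPrimitiveIdempotent e) : IsPrimitiveIdempotent (g e) :=
  .of_map (g.symm : T →+* R) (fun _ _ h0 => by simpa using h0) (h.idem.map g) (by simpa using h)

/-- A generator of a minimal left ideal among those generated by nonzero idempotents is primitive:
for `e = a + b`, `R a = R e` gives `e = c * a`, hence `b = e * b = c * a * b = 0`. -/
theorem exists_isPrimitiveIdempotent (R : Type*) [Ring R] [IsArtinianRing R] [Nontrivial R] :
    ∃ e : R, IsPrimitiveIdempotent e := by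
  obtain ⟨_, ⟨e, he, he0, rfl⟩, hmin⟩ := IsArtinian.set_has_minimal
    {M : Ideal R | ∃ e : R, IsIdempotentElem e ∧ e ≠ 0 ∧ M = Ideal.span {e}}
    ⟨_, 1, IsIdempotentElem.one, one_ne_zero, rfl⟩
  refine ⟨e, he, he0, fun a b ha hb hab hba hsum => ?_⟩
  by_contra! hne
  have hae : a * e = a := by rw [hsum, mul_add, ha.eq, hab, add_zero]
  refine hmin _ ⟨a, ha, hne.1, rfl⟩ (lt_of_le_of_ne ?_ fun heq => hne.2 ?_)
  · exact (Ideal.span_singleton_le_iff_mem _).2 (Ideal.mem_span_singleton'.2 ⟨a, hae⟩)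
  · obtain ⟨c, hc⟩ := Ideal.mem_span_singleton'.1 (heq ▸ Ideal.mem_span_singleton_self e)
    have : e * b = b := by rw [hsum, add_mul, hab, hb.eq, zero_add]
    rw [← this, ← hc, mul_assoc, hab, mul_zero]

theorem IsPrimitiveIdempotent.single {ι : Type*} [DecidableEq ι] {S : ι → Type*}
    [∀ i, Ring (S i)] {i : ι} {s : S i} (hs : IsPrimitiveIdempotent s) :
    IsPrimitiveIdempotent (Pi.single i s : ∀ i, S i) where
  idem := by rw [IsIdempotentElem, ← Pi.single_mul, hs.idem.eq]
  ne_zero := by simpa using hs.ne_zero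
  indecomposable a b ha hb hab hba hsum := by
    have key {a b : ∀ i, S i} (ha : IsIdempotentElem a) (hab : a * b = 0)
        (hsum : Pi.single i s = a + b) (h0 : a i = 0) : a = 0 := by
      funext j
      obtain rfl | hj := eq_or_ne j i
      · exact h0
      -- Away from `i` the sum vanishes, and multiplying it by `a j` leaves `a j`.
      · have h1 : a j + b j = 0 := by
          have := congrFun hsum j
          rwa [Pi.single_eq_of_ne hj, eq_comm] at this
        have h2 : a j * (a j + b j) = a j := by
          rw [mul_add, ← Pi.mul_apply, ← Pi.mul_apply, ha.eq, hab, Pi.zero_apply, add_zero]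
        rw [← h2, h1, mul_zero, Pi.zero_apply]
    refine (hs.indecomposable (a i) (b i) (congrFun ha i) (congrFun hb i) (congrFun hab i)
      (congrFun hba i) (by simpa using congrFun hsum i)).imp (key ha hab hsum)
      (key hb hba (by rw [hsum, add_comm]))

theorem not_idempotentEquiv_single {ι : Type*} [DecidableEq ι] {S : ι → Type*}
    [∀ i, Ring (S i)] {i j : ι} (hij : i ≠ j) {s : S i} (hs : s ≠ 0) (t : S j) :
    ¬ IdempotentEquiv (Pi.single i s : ∀ i, S i) (Pi.single j t) := by
  rintro ⟨x, y, h1, -, -, h4, -, -⟩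
  apply hs
  have hx : x i = 0 := by
    rw [← h4, Pi.mul_apply, Pi.single_eq_of_ne hij, mul_zero]
  have := congrFun h1 i
  rw [Pi.mul_apply, hx, zero_mul, Pi.single_eq_same] at this
  exact this.symm

/-- `1 - a` has a left inverse and annihilates `a`. -/
theorem IsIdempotentElem.eq_zero_of_mem_jacobson {R : Type*} [Ring R] {a : R}
    (ha : IsIdempotentElem a) (h : a ∈ Ring.jacobson R) : a = 0 := by
  obtain ⟨z, hz⟩ := Ideal.mem_jacobson_iff.1 (Ideal.jacobson_bot (R := R) ▸ h) (-1)
  have h1 : z * (1 - a) = 1 := by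
    rw [Ideal.mem_bot, mul_neg, mul_one, sub_eq_zero] at hz
    rw [mul_sub, mul_one, ← hz, neg_mul, neg_add_eq_sub]
  rw [← one_mul a, ← h1, mul_assoc, sub_mul, one_mul, ha.eq, sub_self, mul_zero]

/-- The kernels of the powers of `f` stabilize at some `N`; an element of `ker f` is `f ^ N` of some
`y`, which lies in `ker f ^ (N + 1) = ker f ^ N`. -/
theorem RingHom.injective_of_surjective_of_isNoetherianRing {R : Type*} [Ring R]
    [IsNoetherianRing R] (f : R →+* R) (hf : Function.Surjective f) : Function.Injective f := by
  have hsucc (n : ℕ) (x : R) : (f ^ (n + 1)) x = f ((f ^ n) x) := by rw [pow_succ']; rfl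
  have hsucc' (n : ℕ) (x : R) : (f ^ (n + 1)) x = (f ^ n) (f x) := by rw [pow_succ]; rfl
  have hsurj (n : ℕ) : Function.Surjective (f ^ n) := by
    induction n with
    | zero => exact Function.surjective_id
    | succ n ih =>
      intro x
      obtain ⟨y, rfl⟩ := hf x
      obtain ⟨z, rfl⟩ := ih y
      exact ⟨z, hsucc n z⟩
  obtain ⟨N, hN⟩ := monotone_stabilizes_iff_noetherian.2 ‹IsNoetherianRing R›
    ⟨fun n => RingHom.ker (f ^ n), monotone_nat_of_le_succ fun n x hx => by
      rw [RingHom.mem_ker] at hx ⊢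
      rw [hsucc, hx, map_zero]⟩
  refine (injective_iff_map_eq_zero f).2 fun x hx => ?_
  obtain ⟨y, rfl⟩ := hsurj N x
  have hy : y ∈ RingHom.ker (f ^ (N + 1)) := by rw [RingHom.mem_ker, hsucc, hx]
  exact (hN (N + 1) N.le_succ).ge hy

/-- A surjection of a left artinian ring onto a ring isomorphic to `R / jacobson R` has
kernel `jacobson R`. -/
theorem RingHom.ker_le_jacobson_of_surjective {R T : Type*} [Ring R] [IsArtinianRing R] [Ring T]
    (φ : (R ⧸ Ring.jacobson R) ≃+* T) (g : R →+* T) (hg : Function.Surjective g) :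
    RingHom.ker g ≤ Ring.jacobson R := by
  let h : R →+* R ⧸ Ring.jacobson R := (φ.symm : T →+* _).comp g
  have hh : Function.Surjective h := φ.symm.surjective.comp hg
  have : RingHomSurjective h := ⟨hh⟩
  have hj (a : R) (ha : a ∈ Ring.jacobson R) : h a = 0 := by
    -- A surjection maps the radical into the radical, and that of `R ⧸ Ring.jacobson R` is zero. So
    -- `h` induces a surjective, hence injective, endomorphism of this quotient.
    have := Ring.le_comap_jacobson h ha
    rwa [Ring.jacobson_quotient_jacobson, Ideal.mem_comap, Ideal.mem_bot] at this
  have hinj := RingHom.injective_of_surjective_of_isNoetherianRing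
    (Ideal.Quotient.lift (Ring.jacobson R) h hj)
    (Ideal.Quotient.lift_surjective_of_surjective _ _ hh)
  intro a ha
  refine Ideal.Quotient.eq_zero_iff_mem.1 (hinj ?_)
  rw [Ideal.Quotient.lift_mk, map_zero]
  change φ.symm (g a) = 0
  rw [(RingHom.mem_ker).1 ha, map_zero]

/-- Pairwise inequivalent primitive idempotents exhaust a complete set of the same size. -/
theorem IsCompletePrimitiveSet.exists_perm {R : Type*} [Ring R] {ι : Type*} [Finite ι]
    {e q : ι → R} (he : IsCompletePrimitiveSet e) (hq : ∀ i, IsPrimitiveIdempotent (q i))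
    (hne : ∀ i j, i ≠ j → ¬ IdempotentEquiv (q i) (q j)) :
    ∃ σ : Equiv.Perm ι, ∀ i, IdempotentEquiv (q i) (e (σ i)) := by
  have h (i : ι) : ∃ j, IdempotentEquiv (q i) (e j) := by
    obtain ⟨j, ⟨g⟩⟩ := he.complete (q i) (hq i)
    exact ⟨j, .of_linearEquiv (hq i).idem (he.primitive j).idem g⟩
  choose σ hσ using h
  have hinj : Function.Injective σ := fun i j hij => by
    by_contra hne'
    exact hne i j hne' ((hσ i).trans (hij ▸ (hσ j).symm))
  exact ⟨Equiv.ofBijective σ (Finite.injective_iff_bijective.1 hinj), hσ⟩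

/-! ### Basic algebras -/

section BasicAlgebra

variable {k R T : Type*} [Field k] [Ring R] [Algebra k R] [Ring T] [Algebra k T]
  {ι : Type*} [Fintype ι]

/-- By orthogonality, `∑ i, e i` fixes each `e i` on both sides, so the basic algebra is the corner
at this sum. -/
theorem mem_basicAlgebra_iff {e : ι → R} (he : OrthogonalIdempotents e) {a : R} :
    a ∈ basicAlgebra k e ↔ (∑ i, e i) * a * ∑ i, e i = a := by
  have expand (b : R) : (∑ i, e i) * b * ∑ i, e i = ∑ i, ∑ j, e i * b * e j := by
    rw [Finset.sum_mul, Finset.sum_mul_sum]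
  refine ⟨?_, fun h => ⟨fun _ _ => a, by rw [← expand, h]⟩⟩
  rintro ⟨y, rfl⟩
  classical
  obtain ⟨E, hE⟩ : ∃ E, E = ∑ i, e i := ⟨_, rfl⟩
  have h1 (i : ι) : E * e i = e i := by
    simp [hE, Finset.sum_mul, he.mul_eq]
  have h2 (i : ι) : e i * E = e i := by
    simp [hE, Finset.mul_sum, he.mul_eq]
  rw [← hE, Finset.mul_sum, Finset.sum_mul]
  refine Finset.sum_congr rfl fun i _ => ?_
  rw [Finset.mul_sum, Finset.sum_mul]
  refine Finset.sum_congr rfl fun j _ => ?_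
  rw [← mul_assoc, ← mul_assoc, h1, mul_assoc, h2]

theorem map_basicAlgebra {g : R →ₐ[k] T} (hg : Function.Surjective g) (e : ι → R) :
    (basicAlgebra k e).map g = basicAlgebra k (fun i => g (e i)) := by
  ext a
  rw [NonUnitalSubalgebra.mem_map]
  constructor
  · rintro ⟨_, ⟨y, rfl⟩, rfl⟩
    exact ⟨fun i j => g (y i j), by simp⟩
  · rintro ⟨y, rfl⟩
    choose z hz using fun i j => hg (y i j)
    exact ⟨_, ⟨z, rfl⟩, by simp [hz]⟩

/-- The witnesses are the sums of the individual ones; cross terms contain a product of two distinct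
orthogonal idempotents. -/
theorem OrthogonalIdempotents.idempotentEquiv_sum {e f : ι → R} (he : OrthogonalIdempotents e)
    (hf : OrthogonalIdempotents f) (σ : Equiv.Perm ι)
    (h : ∀ i, IdempotentEquiv (e i) (f (σ i))) :
    IdempotentEquiv (∑ i, e i) (∑ i, f i) := by
  classical
  choose x y h1 h2 h3 h4 h5 h6 using h
  rw [← Equiv.sum_comp σ f]
  have key {a b u v : ι → R} (hv : OrthogonalIdempotents v) (ha : ∀ i, a i * v i = a i)
      (hb : ∀ i, v i * b i = b i) (hab : ∀ i, a i * b i = u i) :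
      (∑ i, a i) * ∑ i, b i = ∑ i, u i := by
    rw [Finset.sum_mul_sum]
    refine Finset.sum_congr rfl fun i _ => ?_
    rw [Finset.sum_eq_single i, hab]
    · intro j _ hj
      rw [← ha i, ← hb j, mul_assoc, ← mul_assoc (v i), hv.ortho hj.symm, zero_mul, mul_zero]
    · simp
  have hf' : OrthogonalIdempotents fun i => f (σ i) := hf.embedding σ.toEmbedding
  exact ⟨∑ i, x i, ∑ i, y i, key hf' h4 h5 h1, key he h6 h3 h2,
    key he (fun i => (he.idem i).eq) h3 h3, key hf' h4 (fun i => (hf'.idem i).eq) h4,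
    key hf' (fun i => (hf'.idem i).eq) h5 h5, key he h6 (fun i => (he.idem i).eq) h6⟩

theorem exists_bijective_basicAlgebra {e f : ι → R} (he : OrthogonalIdempotents e)
    (hf : OrthogonalIdempotents f) (σ : Equiv.Perm ι)
    (h : ∀ i, IdempotentEquiv (e i) (f (σ i))) :
    ∃ g : basicAlgebra k e →ₙₐ[k] basicAlgebra k f, Function.Bijective g := by
  obtain ⟨x, y, h1, h2, h3, h4, h5, h6⟩ := he.idempotentEquiv_sum hf σ h
  have mem (a : R) : y * a * x ∈ basicAlgebra k f := by
    rw [mem_basicAlgebra_iff hf, ← mul_assoc, ← mul_assoc, h5, mul_assoc, h4]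
  have mem' (a : R) : x * a * y ∈ basicAlgebra k e := by
    rw [mem_basicAlgebra_iff he, ← mul_assoc, ← mul_assoc, h3, mul_assoc, h6]
  -- Inserting `x * y` between two factors is what makes `a ↦ y * a * x` multiplicative.
  have hl {a : R} (ha : a ∈ basicAlgebra k e) : x * y * a = a := by
    rw [h1, ← (mem_basicAlgebra_iff he).1 ha, ← mul_assoc, ← mul_assoc,
      he.isIdempotentElem_sum.eq]
  let g : basicAlgebra k e →ₙₐ[k] basicAlgebra k f :=
    { toFun := fun a => ⟨y * a * x, mem a⟩
      map_smul' := fun c a => Subtype.ext (by simp)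
      map_zero' := Subtype.ext (by simp)
      map_add' := fun a b => Subtype.ext (by simp [mul_add, add_mul])
      map_mul' := fun a b => Subtype.ext (by
        change y * (a * b : R) * x = y * a * x * (y * b * x)
        conv_lhs => rw [← hl b.2]
        simp only [mul_assoc]) }
  refine ⟨g, Function.bijective_iff_has_inverse.2 ⟨fun b => ⟨x * b * y, mem' b⟩, ?_, ?_⟩⟩
  · intro a
    apply Subtype.ext
    change x * (y * a * x) * y = (a : R)
    rw [← mul_assoc, ← mul_assoc, h1, mul_assoc _ x y, h1,
      (mem_basicAlgebra_iff he).1 a.2]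
  · intro b
    apply Subtype.ext
    change y * (x * b * y) * x = (b : R)
    rw [← mul_assoc, ← mul_assoc, h2, mul_assoc _ y x, h2,
      (mem_basicAlgebra_iff hf).1 b.2]

theorem exists_bijective_basicAlgebra_of_algEquiv (π : R ≃ₐ[k] T) (e : ι → R) :
    ∃ g : basicAlgebra k e →ₙₐ[k] basicAlgebra k (fun i => π (e i)), Function.Bijective g := by
  have hmap : (basicAlgebra k e).map π = basicAlgebra k (fun i => π (e i)) :=
    map_basicAlgebra (g := (π : R →ₐ[k] T)) π.surjective e
  rw [← hmap]
  refine ⟨{ toFun := fun a => ⟨π a, NonUnitalSubalgebra.mem_map.2 ⟨a, a.2, rfl⟩⟩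
            map_smul' := fun c a => Subtype.ext (by simp)
            map_zero' := Subtype.ext (by simp)
            map_add' := fun a b => Subtype.ext (by simp)
            map_mul' := fun a b => Subtype.ext (by simp) }, fun a b hab => ?_, fun b => ?_⟩
  · exact Subtype.ext (π.injective (congrArg Subtype.val hab))
  · obtain ⟨a, ha, hab⟩ := NonUnitalSubalgebra.mem_map.1 b.2
    exact ⟨⟨a, ha⟩, Subtype.ext hab⟩

end BasicAlgebra

/-! ### The augmentation and the length filtration of a generalized path algebra -/

namespace GenPathAlgebra

variable {k : Type*} [Field k] {ι : Type*} [Fintype ι] {Q : ι → ι → Type*}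
  {S : ι → Type*} [∀ i, Ring (S i)] [∀ i, Algebra k (S i)]

theorem elt_add (i : ι) (a b : S i) : elt k Q S i (a + b) = elt k Q S i a + elt k Q S i b :=
  (RingQuot.mkAlgHom_rel k (PathRel.add (Q := Q) i a b)).trans (map_add _ _ _)

theorem elt_smul (i : ι) (c : k) (a : S i) : elt k Q S i (c • a) = c • elt k Q S i a :=
  (RingQuot.mkAlgHom_rel k (PathRel.smul (Q := Q) i c a)).trans (map_smul _ _ _)

theorem elt_mul (i : ι) (a b : S i) : elt k Q S i (a * b) = elt k Q S i a * elt k Q S i b :=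
  (RingQuot.mkAlgHom_rel k (PathRel.mul (Q := Q) i a b)).symm.trans (map_mul _ _ _)

theorem elt_mul_of_ne {i j : ι} (h : i ≠ j) (a : S i) (b : S j) :
    elt k Q S i a * elt k Q S j b = 0 :=
  (map_mul _ _ _).symm.trans
    ((RingQuot.mkAlgHom_rel k (PathRel.mul_of_ne (Q := Q) i j h a b)).trans (map_zero _))

theorem sum_elt_one : ∑ i, elt k Q S i 1 = 1 :=
  (map_sum _ _ _).symm.trans
    ((RingQuot.mkAlgHom_rel k (PathRel.one (k := k) (Q := Q) (S := S))).trans (map_one _))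

theorem elt_one_mul_arrow (i j : ι) (β : Q i j) :
    elt k Q S j 1 * arrow k Q S i j β = arrow k Q S i j β :=
  (map_mul _ _ _).symm.trans (RingQuot.mkAlgHom_rel k (PathRel.target (S := S) i j β))

theorem arrow_mul_elt_one (i j : ι) (β : Q i j) :
    arrow k Q S i j β * elt k Q S i 1 = arrow k Q S i j β :=
  (map_mul _ _ _).symm.trans (RingQuot.mkAlgHom_rel k (PathRel.source (S := S) i j β))

/-- The universal property of the generalized path algebra. -/
noncomputable def lift {T : Type*} [Ring T] [Algebra k T] (g : PathLetter Q S → T)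
    (h : ∀ ⦃x y⦄, PathRel k Q S x y → FreeAlgebra.lift k g x = FreeAlgebra.lift k g y) :
    GenPathAlgebra k Q S →ₐ[k] T :=
  RingQuot.liftAlgHom k ⟨FreeAlgebra.lift k g, h⟩

section lift

variable {T : Type*} [Ring T] [Algebra k T] (g : PathLetter Q S → T)
  (h : ∀ ⦃x y⦄, PathRel k Q S x y → FreeAlgebra.lift k g x = FreeAlgebra.lift k g y)

theorem lift_elt (i : ι) (a : S i) : lift g h (elt k Q S i a) = g (.elt i a) :=
  (RingQuot.liftAlgHom_mkAlgHom_apply k _ h _).trans (FreeAlgebra.lift_ι_apply _ _)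

theorem lift_arrow (i j : ι) (β : Q i j) : lift g h (arrow k Q S i j β) = g (.arrow i j β) :=
  (RingQuot.liftAlgHom_mkAlgHom_apply k _ h _).trans (FreeAlgebra.lift_ι_apply _ _)

end lift

/-- A subalgebra containing all letters is everything. -/
theorem subalgebra_eq_top (U : Subalgebra k (GenPathAlgebra k Q S))
    (helt : ∀ i a, elt k Q S i a ∈ U) (harrow : ∀ i j β, arrow k Q S i j β ∈ U) : U = ⊤ := by
  refine SetLike.ext fun x => iff_of_true ?_ Algebra.mem_top
  obtain ⟨w, rfl⟩ := RingQuot.mkAlgHom_surjective k (PathRel k Q S) x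
  induction w using FreeAlgebra.induction with
  | grade0 c => rw [AlgHom.commutes]; exact U.algebraMap_mem c
  | grade1 l =>
    cases l with
    | elt i a => exact helt i a
    | arrow i j β => exact harrow i j β
  | mul a b ha hb => rw [map_mul]; exact U.mul_mem ha hb
  | add a b ha hb => rw [map_add]; exact U.add_mem ha hb

theorem lengthZero_single [DecidableEq ι] (i : ι) (a : S i) :
    lengthZero k Q S (Pi.single i a) = elt k Q S i a := by
  have h0 (j : ι) : elt k Q S j 0 = 0 := by simpa using elt_smul (Q := Q) j (0 : k) (0 : S j)
  rw [lengthZero, Finset.sum_eq_single i, Pi.single_eq_same]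
  · intro j _ hj
    rw [Pi.single_eq_of_ne hj, h0]
  · simp

variable (k Q S)

/-- The inclusion of the elements of length zero. -/
noncomputable def lengthZeroHom : (∀ i, S i) →ₐ[k] GenPathAlgebra k Q S :=
  AlgHom.ofLinearMap
    { toFun := lengthZero k Q S
      map_add' := fun x y => by simp [lengthZero, elt_add, Finset.sum_add_distrib]
      map_smul' := fun c x => by simp [lengthZero, elt_smul, Finset.smul_sum] }
    sum_elt_one
    (fun x y => by
      classical
      change ∑ i, elt k Q S i (x i * y i) = (∑ i, elt k Q S i (x i)) * ∑ i, elt k Q S i (y i)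
      rw [Finset.sum_mul_sum]
      refine Finset.sum_congr rfl fun i _ => ?_
      rw [Finset.sum_eq_single i, elt_mul]
      · exact fun j _ hj => elt_mul_of_ne hj.symm _ _
      · simp)

open Polynomial in
/-- The grading by length: an arrow is multiplied by the variable. -/
noncomputable def lengthGrading : GenPathAlgebra k Q S →ₐ[k] (GenPathAlgebra k Q S)[X] :=
  lift (fun l => match l with
      | .elt i a => C (elt k Q S i a)
      | .arrow i j β => C (arrow k Q S i j β) * X) (by
    intro x y h
    cases h with
    | add i a b => simp [elt_add]
    | smul i c a => simp [elt_smul, smul_C]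
    | mul i a b => simp [elt_mul]
    | mul_of_ne i j h a b =>
      simp only [map_mul, FreeAlgebra.lift_ι_apply, map_zero]
      rw [← C_mul, elt_mul_of_ne h, C_0]
    | one =>
      simp only [map_sum, FreeAlgebra.lift_ι_apply, map_one]
      rw [← map_sum, sum_elt_one, C_1]
    | target i j β =>
      simp only [map_mul, FreeAlgebra.lift_ι_apply]
      rw [← mul_assoc, ← C_mul, elt_one_mul_arrow]
    | source i j β =>
      simp only [map_mul, FreeAlgebra.lift_ι_apply]
      rw [mul_assoc, X_mul_C, ← mul_assoc, ← C_mul, arrow_mul_elt_one])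

-- Shows that the length grading is injective. Evaluation at `1` is a ring homomorphism because `1`
-- is central.
open Polynomial in
theorem eval_one_lengthGrading (x : GenPathAlgebra k Q S) :
    (lengthGrading k Q S x).eval 1 = x := by
  let c : (GenPathAlgebra k Q S)[X] →ₐ[k] GenPathAlgebra k Q S :=
    { Polynomial.eval₂RingHom' (RingHom.id _) 1 (fun a => Commute.one_right a) with
      commutes' := fun r => by simp [Polynomial.algebraMap_apply] }
  have h : AlgHom.equalizer (c.comp (lengthGrading k Q S)) (AlgHom.id k _) = ⊤ := by
    refine subalgebra_eq_top _ (fun i a => ?_) fun i j β => ?_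
    · change (lengthGrading k Q S _).eval 1 = _
      rw [lengthGrading, lift_elt, eval_C]
      rfl
    · change (lengthGrading k Q S _).eval 1 = _
      rw [lengthGrading, lift_arrow, eval_mul_X, eval_C, mul_one]
      rfl
  exact (h ▸ Algebra.mem_top : x ∈ AlgHom.equalizer _ _)

variable [DecidableEq ι]

/-- The projection onto the elements of length zero, which annihilates the arrows. -/
noncomputable def augmentation : GenPathAlgebra k Q S →ₐ[k] (∀ i, S i) :=
  lift (fun l => match l with
      | .elt i a => Pi.single i a
      | .arrow _ _ _ => 0) (by
    intro x y h
    cases h with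
    | add i a b => simp [Pi.single_add]
    | smul i c a => simp [Pi.single_smul]
    | mul i a b => simp [Pi.single_mul]
    | mul_of_ne i j h a b =>
      simp only [map_mul, FreeAlgebra.lift_ι_apply, map_zero]
      funext l
      obtain rfl | hl := eq_or_ne l i
      · simp [Pi.single_eq_of_ne h]
      · simp [Pi.single_eq_of_ne hl]
    | one =>
      simp only [map_sum, FreeAlgebra.lift_ι_apply, map_one]
      exact Finset.univ_sum_single (1 : ∀ i, S i)
    | target i j β => simp
    | source i j β => simp)

theorem augmentation_elt (i : ι) (a : S i) :
    augmentation k Q S (elt k Q S i a) = Pi.single i a := lift_elt _ _ _ _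

theorem augmentation_arrow (i j : ι) (β : Q i j) :
    augmentation k Q S (arrow k Q S i j β) = 0 := lift_arrow _ _ _ _ _

theorem augmentation_lengthZero (x : ∀ i, S i) :
    augmentation k Q S (lengthZero k Q S x) = x := by
  rw [lengthZero, map_sum]
  simp only [augmentation_elt]
  exact Finset.univ_sum_single x

theorem arrowIdeal_le_ker : arrowIdeal k Q S ≤ RingHom.ker (augmentation k Q S) := by
  intro x hx
  have : TwoSidedIdeal.span {x : GenPathAlgebra k Q S | ∃ (i j : ι) (β : Q i j) (b : S j)
      (a : S i), x = elt k Q S j b * arrow k Q S i j β * elt k Q S i a} ≤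
      TwoSidedIdeal.ker (augmentation k Q S) := by
    rw [TwoSidedIdeal.span_le]
    rintro _ ⟨i, j, β, b, a, rfl⟩
    rw [SetLike.mem_coe, TwoSidedIdeal.mem_ker]
    simp [augmentation_arrow]
  exact (TwoSidedIdeal.mem_ker _).1 (this (TwoSidedIdeal.mem_asIdeal.1 hx))

open Polynomial in
theorem coeff_zero_lengthGrading (x : GenPathAlgebra k Q S) :
    (lengthGrading k Q S x).coeff 0 = lengthZero k Q S (augmentation k Q S x) := by
  let c : (GenPathAlgebra k Q S)[X] →ₐ[k] GenPathAlgebra k Q S :=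
    { Polynomial.constantCoeff with commutes' := fun r => by simp }
  have h : AlgHom.equalizer (c.comp (lengthGrading k Q S))
      ((lengthZeroHom k Q S).comp (augmentation k Q S)) = ⊤ := by
    refine subalgebra_eq_top _ (fun i a => ?_) fun i j β => ?_
    · change (lengthGrading k Q S _).coeff 0 = lengthZero k Q S (augmentation k Q S _)
      rw [lengthGrading, lift_elt, coeff_C_zero, augmentation_elt, lengthZero_single]
    · change (lengthGrading k Q S _).coeff 0 = lengthZeroHom k Q S (augmentation k Q S _)
      rw [lengthGrading, lift_arrow, coeff_mul_X_zero, augmentation_arrow, map_zero]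
  exact (h ▸ Algebra.mem_top : x ∈ AlgHom.equalizer _ _)

-- The polynomial of `a` has no constant term, so it is divisible by the central `X`. Being
-- idempotent, it is then divisible by every power of `X`, hence zero.
open Polynomial in
theorem eq_zero_of_augmentation_eq_zero {a : GenPathAlgebra k Q S} (ha : IsIdempotentElem a)
    (h : augmentation k Q S a = 0) : a = 0 := by
  have hX : (X : (GenPathAlgebra k Q S)[X]) ∣ lengthGrading k Q S a := by
    rw [X_dvd_iff, coeff_zero_lengthGrading, h]
    exact map_zero (lengthZeroHom k Q S)
  have hpow (n : ℕ) : (X : (GenPathAlgebra k Q S)[X]) ^ n ∣ lengthGrading k Q S a := by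
    induction n with
    | zero => rw [pow_zero]; exact one_dvd _
    | succ n ih =>
      obtain ⟨p, hp⟩ := ih
      obtain ⟨q, hq⟩ := hX
      refine ⟨p * q, ?_⟩
      rw [← ha.eq, map_mul]
      nth_rewrite 1 [hp]
      rw [hq, pow_succ, mul_assoc, ← mul_assoc p, ← X_mul, mul_assoc, mul_assoc]
  have h0 : lengthGrading k Q S a = 0 := by
    ext n
    exact X_pow_dvd_iff.1 (hpow (n + 1)) n n.lt_succ_self
  rw [← eval_one_lengthGrading k Q S a, h0, eval_zero]

end GenPathAlgebra

/-! ### Comparison of the basic algebras -/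

/-- The basic algebras of `A` and of its presentation agree if the idempotents `d i` come, up to
equivalence, from pairwise inequivalent primitive idempotents of length zero. -/
theorem exists_bijective_basicAlgebra_map {k A : Type*} [Field k] [Ring A] [Algebra k A]
    [IsArtinianRing A] {ι : Type*} [Fintype ι] [DecidableEq ι] {Q : ι → ι → Type*}
    {S : ι → Type*} [∀ i, Ring (S i)] [∀ i, Algebra k (S i)]
    (φ : (A ⧸ Ring.jacobson A) ≃ₐ[k] (∀ i, S i)) {I : Ideal (GenPathAlgebra k Q S)}
    [I.IsTwoSided] (hI : I ≤ GenPathAlgebra.arrowIdeal k Q S)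
    (π : A ≃ₐ[k] (GenPathAlgebra k Q S ⧸ I)) {ε : ι → A} (hε : IsCompletePrimitiveSet ε)
    {d : ι → GenPathAlgebra k Q S} (hd : OrthogonalIdempotents d) {δ : ι → ∀ i, S i}
    (hδ : ∀ i, IsPrimitiveIdempotent (δ i))
    (hne : ∀ i j, i ≠ j → ¬ IdempotentEquiv (δ i) (δ j)) (τ : Equiv.Perm ι)
    (h : ∀ i, IdempotentEquiv (GenPathAlgebra.lengthZero k Q S (δ i)) (d (τ i))) :
    ∃ f : basicAlgebra k ε →ₙₐ[k] (basicAlgebra k d).map (Ideal.Quotient.mkₐ k I),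
      Function.Bijective f := by
  let P := GenPathAlgebra.augmentation k Q S
  let L := GenPathAlgebra.lengthZeroHom k Q S
  have hPL (x : ∀ i, S i) : P (L x) = x := GenPathAlgebra.augmentation_lengthZero k Q S x
  -- The inclusion `I ≤ J` is what lets the augmentation descend to `R / I`.
  let P' : GenPathAlgebra k Q S ⧸ I →+* ∀ i, S i :=
    Ideal.Quotient.lift I (P : GenPathAlgebra k Q S →+* ∀ i, S i)
      fun a ha => GenPathAlgebra.arrowIdeal_le_ker k Q S (hI ha)
  let g : A →+* ∀ i, S i := P'.comp (π : A →+* GenPathAlgebra k Q S ⧸ I)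
  let q (i : ι) : A := π.symm (Ideal.Quotient.mk I (L (δ i)))
  have hπq (i : ι) : π (q i) = Ideal.Quotient.mk I (L (δ i)) := π.apply_symm_apply _
  have hgq' (x : ∀ i, S i) : g (π.symm (Ideal.Quotient.mk I (L x))) = x := by
    change P' (π (π.symm _)) = x
    rw [π.apply_symm_apply]
    exact hPL x
  have hgq (i : ι) : g (q i) = δ i := hgq' (δ i)
  have hker := RingHom.ker_le_jacobson_of_surjective (φ : _ ≃+* ∀ i, S i) g
    fun x => ⟨_, hgq' x⟩
  have hq (i : ι) : IsPrimitiveIdempotent (q i) :=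
    .of_map g (fun a ha h0 => ha.eq_zero_of_mem_jacobson (hker h0))
      ((((hδ i).idem.map L).map (Ideal.Quotient.mk I)).map π.symm) (by rw [hgq]; exact hδ i)
  obtain ⟨σ, hσ⟩ := hε.exists_perm hq fun i j hij hqq =>
    hne i j hij (by simpa only [hgq] using hqq.map g)
  obtain ⟨f₁, hf₁⟩ := exists_bijective_basicAlgebra_of_algEquiv π ε
  -- In `R / I`, `π (ε i)` is equivalent to the image of the length-zero element of `δ (σ⁻¹ i)`, and
  -- this to the image of `d (τ (σ⁻¹ i))`.
  obtain ⟨f₂, hf₂⟩ := exists_bijective_basicAlgebra (k := k)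
    (hε.orthogonal.map (π : A →+* GenPathAlgebra k Q S ⧸ I))
    (hd.map (Ideal.Quotient.mk I)) (σ.symm.trans τ) fun i => by
      have h1 := (hσ (σ.symm i)).symm.map (π : A →+* GenPathAlgebra k Q S ⧸ I)
      rw [σ.apply_symm_apply] at h1
      refine h1.trans ?_
      change IdempotentEquiv (π (q _)) _
      rw [hπq]
      exact (h (σ.symm i)).map (Ideal.Quotient.mk I)
  rw [map_basicAlgebra (Ideal.Quotient.mkₐ_surjective k I)]
  exact ⟨f₂.comp f₁, hf₂.comp hf₁⟩

theorem theorem3p5 {k A : Type*} [Field k] [Ring A] [Algebra k A] [IsArtinianRing A]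
    {ι : Type*} [Fintype ι] [DecidableEq ι]
    (S : ι → Type*) [∀ i, Ring (S i)] [∀ i, Algebra k (S i)] [∀ i, IsSimpleRing (S i)]
    (φ : (A ⧸ Ring.jacobson A) ≃ₐ[k] (∀ i, S i))
    (I : Ideal (GenPathAlgebra k (NaturalQuiver φ) S)) [I.IsTwoSided]
    (hI : I ≤ GenPathAlgebra.arrowIdeal k (NaturalQuiver φ) S)
    (π : A ≃ₐ[k] (GenPathAlgebra k (NaturalQuiver φ) S ⧸ I))
    (ε : ι → A) (hε : IsCompletePrimitiveSet ε)
    (d : ι → GenPathAlgebra k (NaturalQuiver φ) S)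
    (hd : IsCompletePrimitiveSet d ∨
      ∃ δ : ι → A ⧸ Ring.jacobson A, IsCompletePrimitiveSet δ ∧
        ∀ i, d i = GenPathAlgebra.lengthZero k (NaturalQuiver φ) S (φ (δ i))) :
    ∃ f : basicAlgebra k ε →ₙₐ[k]
        (basicAlgebra k d).map (Ideal.Quotient.mkₐ k I),
      Function.Bijective f := by
  let L := GenPathAlgebra.lengthZeroHom k (NaturalQuiver φ) S
  rcases hd with hd | ⟨δ, hδ, hdδ⟩
  -- Each `S i` is a quotient of `A`, hence artinian, and contributes one primitive idempotent.
  -- Idempotents from different blocks are inequivalent.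
  · have hart (i : ι) : IsArtinianRing (S i) := by
      let g : A →+* S i := (Pi.evalRingHom S i).comp
        ((φ : _ →+* ∀ i, S i).comp (Ideal.Quotient.mk (Ring.jacobson A)))
      exact Function.Surjective.isArtinianRing (f := g) ((Function.surjective_eval i).comp
        (φ.surjective.comp Ideal.Quotient.mk_surjective))
    choose s hs using fun i => exists_isPrimitiveIdempotent (S i)
    have hδ (i : ι) : IsPrimitiveIdempotent (Pi.single i (s i) : ∀ i, S i) := (hs i).single
    have hne (i j : ι) (hij : i ≠ j) :
        ¬ IdempotentEquiv (Pi.single i (s i) : ∀ i, S i) (Pi.single j (s j)) :=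
      not_idempotentEquiv_single hij (hs i).ne_zero (s j)
    have hPL := GenPathAlgebra.augmentation_lengthZero k (NaturalQuiver φ) S
    obtain ⟨τ, hτ⟩ := hd.exists_perm (q := fun i => L (Pi.single i (s i)))
      (fun i => .of_map (GenPathAlgebra.augmentation k (NaturalQuiver φ) S : _ →+* ∀ i, S i)
        (fun a ha h0 => GenPathAlgebra.eq_zero_of_augmentation_eq_zero k (NaturalQuiver φ) S ha h0)
        ((hδ i).idem.map L) ((hPL (Pi.single i (s i))).symm ▸ hδ i))
      fun i j hij hqq => hne i j hij (by
        have := hqq.map (GenPathAlgebra.augmentation k (NaturalQuiver φ) S : _ →+* ∀ i, S i)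
        exact hPL (Pi.single i (s i)) ▸ hPL (Pi.single j (s j)) ▸ this)
    exact exists_bijective_basicAlgebra_map φ hI π hε hd.orthogonal hδ hne τ hτ
  -- Here the `d i` are themselves the length-zero idempotents, so the permutation is the identity.
  · obtain rfl : d = fun i => L (φ (δ i)) := funext hdδ
    have horth : OrthogonalIdempotents fun i => L (φ (δ i)) :=
      hδ.orthogonal.map (L.comp (φ : (A ⧸ Ring.jacobson A) →ₐ[k] ∀ i, S i)).toRingHom
    refine exists_bijective_basicAlgebra_map φ hI π hε horth (δ := fun i => φ (δ i))
      (fun i => (hδ.primitive i).map_equiv φ.toRingEquiv) (fun i j hij h => ?_)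
      (Equiv.refl ι) fun i => .refl (horth.idem i)
    have h' := h.map φ.symm.toRingEquiv.toRingHom
    have hs (a : A ⧸ Ring.jacobson A) : φ.symm.toRingEquiv.toRingHom (φ a) = a :=
      φ.symm_apply_apply a
    rw [hs, hs] at h'
    exact (hδ.non_iso i j hij).elim h'.nonempty_linearEquiv.some
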